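/- Let $M$ be a finite matroid of rank $r\ge 2$ with ground set $X$ (loops and parallel elements are allowed), let $R\subseteq X$, and let $a$ be an integer with $1\le a\le r-1$. For $0\le b\le r$ put $$P(M,R,b):=\binom{r}{b}^{-1}\,\bigl|\{B : B \text{ is a basis of } M,\ |B\cap R|=b\}\bigr| .$$ For a matroid $N$ and a non-loop $x$ of $N$ (an element such that $\{x\}$ is independent in $N$), let $\mathrm{Par}_N(x)$ denote the parallel class of $x$, i.e. the set consisting of $x$ itself and of all non-loops $y\neq x$ of $N$ such that $\{x,y\}$ is not independent in $N$. Suppose that $P(M,R,a)>0$. Then $$P(M,R,a)^2 = P(M,R,a+1)\,P(M,R,a-1)$$ holds if and only if there is a real number $s>0$ such that, for every independent set $A\subseteq X$ of $M$ with $|A|=r-2$ and $|A\cap R|=a-1$, and for every non-loop $x$ of the contraction $M/A$, $$\bigl|\mathrm{Par}_{M/A}(x)\cap R\bigr| = s\,\bigl|\mathrm{Par}_{M/A}(x)\cap (X\setminus R)\bigr| .$$ -/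

import Mathlib

noncomputable section

namespace Matroid

variable {α : Type*}

/-- The rank of `M` as a natural number (the common size of the bases of a finite matroid). -/
def natRank (M : Matroid α) : ℕ := M.eRank.toNat

/-- The number of bases of `M` that meet `R` in exactly `a` elements. -/
def baseCount (M : Matroid α) (R : Set α) (a : ℕ) : ℕ :=
  {B : Set α | M.IsBase B ∧ (B ∩ R).ncard = a}.ncard

/-- The normalized count: the number of bases meeting `R` in exactly `a` elements,
divided by the binomial coefficient of the rank over `a`. -/
def normBaseCount (M : Matroid α) (R : Set α) (a : ℕ) : ℝ :=
  (M.baseCount R a : ℝ) / (M.natRank.choose a : ℝ)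

/-- The parallel class of a non-loop `x`: the equivalence class of `x` under parallelism of
non-loops. The clause `y = x` is needed since `{x, x} = {x}` is independent. -/
def parallelClass (M : Matroid α) (x : α) : Set α :=
  {y | M.IsNonloop y ∧ (y = x ∨ ¬ M.Indep {x, y})}

end Matroid

end

/-! Write ρ and σ for the indicators of R and of its complement. Up to the common factor r!,
P(M,R,b) is the mixed derivative of the basis generating polynomial along b copies of ρ and r - b
copies of σ (`normBaseCount_eq_mixedCount`). With a - 1 copies of ρ and r - 1 - a copies of σ held
fixed, the three consecutive values become B(ρ,ρ), B(ρ,σ), B(σ,σ) for one symmetric bilinear form B,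
a `mixedForm`.

Such forms have at most one positive direction (`mixedForm_hyperbolic`), an analogue of the
Alexandrov–Fenchel inequality. In rank two this is an explicit computation on parallel classes. In
higher rank it follows from the forms above I ∪ {i} by a spectral local-to-global argument
(`Matrix.quadratic_nonpos_of_orthogonal`).

Equality in the reversed Cauchy–Schwarz inequality puts ρ - sσ, for a suitable s > 0, into the
radical of B. This membership descends to the forms obtained by fixing one more element
(`mixedCount_radical_insert`), down to the rank two forms above the independent sets A of the
theorem. There, a vector is in the radical iff it sums to zero on every parallel class of M/A, which
is the stated proportion. Conversely, B is a nonnegative combination of these rank two forms, so a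
common radical vector ρ - sσ lies in the radical of B and makes the three values a geometric
progression. -/

/-! ### Reversed Cauchy–Schwarz inequality and its equality case -/

section BilinForm

variable {V : Type*} [AddCommGroup V] [Module ℝ V]

/-- A symmetric bilinear form that is nonpositive on the orthogonal complement of one vector
satisfies the reversed Cauchy–Schwarz inequality. -/
theorem LinearMap.BilinForm.mul_self_le_sq_of_nonpos_on_orthogonal
    (B : LinearMap.BilinForm ℝ V) (hB : ∀ x y, B x y = B y x) (w : V)
    (hw : ∀ v, B w v = 0 → B v v ≤ 0) (u v : V) (hu : 0 ≤ B u u) :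
    B u u * B v v ≤ B u v ^ 2 := by
  by_contra! h
  have hpos : 0 < B u u * B v v := lt_of_le_of_lt (sq_nonneg _) h
  have hu' : 0 < B u u := lt_of_le_of_ne hu (fun h0 => by simp [← h0] at hpos)
  have h1 : B w (B w v • u - B w u • v) = 0 := by
    simp only [map_sub, map_smul, smul_eq_mul]; ring
  have h2 := hw _ h1
  have h3 : B (B w v • u - B w u • v) (B w v • u - B w u • v) =
      B w v ^ 2 * B u u - 2 * (B w v * B w u) * B u v + B w u ^ 2 * B v v := by
    simp only [map_sub, map_smul, smul_eq_mul, LinearMap.sub_apply, LinearMap.smul_apply, hB v u]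
    ring
  rw [h3] at h2
  -- Multiply by `B u u` and complete the square. By `h` the second summand then forces `B w u = 0`,
  -- so `u` itself is a positive vector orthogonal to `w`.
  have h4 : (B u u * B w v - B w u * B u v) ^ 2 + B w u ^ 2 * (B u u * B v v - B u v ^ 2) ≤ 0 := by
    have := mul_nonpos_of_nonneg_of_nonpos hu'.le h2
    nlinarith [this]
  have h5 : B w u ^ 2 * (B u u * B v v - B u v ^ 2) ≤ 0 := by
    nlinarith [sq_nonneg (B u u * B w v - B w u * B u v)]
  have h6 : B w u = 0 := by
    by_contra hne
    exact absurd h5 (not_le.2 (mul_pos (by positivity) (by linarith)))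
  exact absurd (hw u h6) (not_le.2 hu')

/-- The equality case of the reversed Cauchy–Schwarz inequality: a null vector orthogonal to a
vector of positive length lies in the radical. -/
theorem LinearMap.BilinForm.eq_zero_of_isotropic_of_orthogonal
    (B : LinearMap.BilinForm ℝ V) (hB : ∀ x y, B x y = B y x) (w : V) (hw : 0 < B w w)
    (hyp : ∀ x, B w w * B x x ≤ B w x ^ 2) (v : V) (hwv : B w v = 0) (hv : B v v = 0) (u : V) :
    B u v = 0 := by
  set z : V := u - (B w u / B w w) • w with hz
  have hwz : B w z = 0 := by
    simp only [hz, map_sub, map_smul, smul_eq_mul]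
    field_simp
    ring
  have huv : B u v = B z v := by
    simp [hz, hwv]
  rw [huv]
  -- The form is nonpositive on the complement of `w`. Moving from the null vector `v` in the
  -- direction `z` gives a quadratic in `t` without constant term, so its linear coefficient must
  -- vanish.
  have key : ∀ t : ℝ, 2 * t * B z v + t ^ 2 * B z z ≤ 0 := by
    intro t
    have h1 := hyp (v + t • z)
    have h2 : B w (v + t • z) = 0 := by simp [hwv, hwz]
    have h3 : B (v + t • z) (v + t • z) = 2 * t * B z v + t ^ 2 * B z z := by
      simp only [map_add, map_smul, smul_eq_mul, LinearMap.add_apply, LinearMap.smul_apply, hv,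
        hB v z]
      ring
    rw [h2, h3] at h1
    by_contra! h
    have := mul_pos hw h
    nlinarith
  by_contra hne
  have hpos : 0 < B z v ^ 2 := by positivity
  -- This `t` is small enough for the linear term to dominate the quadratic one, and has the sign
  -- that makes it positive.
  have k1 := key (B z v / (1 + |B z z|))
  have hd : 0 < 1 + |B z z| := by positivity
  have e : 2 * (B z v / (1 + |B z z|)) * B z v + (B z v / (1 + |B z z|)) ^ 2 * B z z =
      B z v ^ 2 * (2 * (1 + |B z z|) + B z z) / (1 + |B z z|) ^ 2 := by
    field_simp
  rw [e] at k1
  have : 0 < B z v ^ 2 * (2 * (1 + |B z z|) + B z z) / (1 + |B z z|) ^ 2 := by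
    have := neg_abs_le (B z z)
    have := abs_nonneg (B z z)
    apply div_pos _ (by positivity)
    exact mul_pos hpos (by linarith)
  linarith

end BilinForm

/-! ### Spectral local-to-global principle -/

section Matrix

variable {ι : Type*} [Fintype ι]

/-- For `Q` symmetric, `w` positive and `p = Q w`, the form `∑ pᵢ vᵢ² / wᵢ - v ⬝ Q v` is a
combination of squares with coefficients `Qᵢⱼ wᵢ wⱼ / 2`. -/
theorem Matrix.sum_div_mul_sq_sub_quadratic (Q : Matrix ι ι ℝ) (hQ : ∀ i j, Q i j = Q j i)
    (w : ι → ℝ) (hw : ∀ i, 0 < w i) (v : ι → ℝ) :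
    2 * (∑ i, (∑ j, Q i j * w j) / w i * v i ^ 2 - ∑ i, ∑ j, v i * (Q i j * v j)) =
      ∑ i, ∑ j, Q i j * w i * w j * (v i / w i - v j / w j) ^ 2 := by
  have h1 : ∑ i, (∑ j, Q i j * w j) / w i * v i ^ 2 =
      ∑ i, ∑ j, Q i j * w i * w j * (v i / w i) ^ 2 := by
    refine Finset.sum_congr rfl fun i _ => ?_
    rw [Finset.sum_div, Finset.sum_mul]
    refine Finset.sum_congr rfl fun j _ => ?_
    have := (hw i).ne'
    field_simp
  have h2 : ∑ i, (∑ j, Q i j * w j) / w i * v i ^ 2 =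
      ∑ i, ∑ j, Q i j * w i * w j * (v j / w j) ^ 2 := by
    rw [h1, Finset.sum_comm]
    refine Finset.sum_congr rfl fun i _ => Finset.sum_congr rfl fun j _ => ?_
    rw [hQ j i]; ring
  have h3 : ∑ i, ∑ j, v i * (Q i j * v j) =
      ∑ i, ∑ j, Q i j * w i * w j * ((v i / w i) * (v j / w j)) := by
    refine Finset.sum_congr rfl fun i _ => Finset.sum_congr rfl fun j _ => ?_
    have := (hw i).ne'
    have := (hw j).ne'
    field_simp
  rw [mul_sub, two_mul]
  nth_rewrite 1 [h1]
  rw [h2, h3, Finset.mul_sum, ← Finset.sum_add_distrib, ← Finset.sum_sub_distrib]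
  refine Finset.sum_congr rfl fun i _ => ?_
  rw [Finset.mul_sum, ← Finset.sum_add_distrib, ← Finset.sum_sub_distrib]
  refine Finset.sum_congr rfl fun j _ => ?_
  ring

/-- Local-to-global principle: a connected symmetric matrix with nonnegative entries whose
normalisation has no eigenvalue in `(0, 1)` has exactly one positive direction. -/
theorem Matrix.quadratic_nonpos_of_orthogonal [DecidableEq ι] (Q : Matrix ι ι ℝ) (hQ : ∀ i j, Q i j = Q j i)
    (hQ0 : ∀ i j, 0 ≤ Q i j) (w p : ι → ℝ) (hw : ∀ i, 0 < w i) (hp : ∀ i, 0 < p i)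
    (hpw : ∀ i, ∑ j, Q i j * w j = p i)
    (hconn : ∀ z : ι → ℝ, (∀ i j, 0 < Q i j → z i = z j) → ∀ i j, z i = z j)
    (hbulk : ∀ v : ι → ℝ, ∑ i, ∑ j, v i * (Q i j * v j) ≤
      ∑ i, w i / p i * (∑ j, Q i j * v j) ^ 2)
    (v : ι → ℝ) (hv : ∑ i, p i * v i = 0) :
    ∑ i, ∑ j, v i * (Q i j * v j) ≤ 0 := by
  -- Conjugation by `d` symmetrises diag(w/p) Q, a matrix that fixes `w`; hence 1 is the expected
  -- top eigenvalue, with eigenvector w/d.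
  set d : ι → ℝ := fun i => √(w i / p i) with hd
  have hdpos : ∀ i, 0 < d i := fun i => Real.sqrt_pos.2 (div_pos (hw i) (hp i))
  have hd2 : ∀ i, d i ^ 2 = w i / p i := fun i => Real.sq_sqrt (div_pos (hw i) (hp i)).le
  set A : Matrix ι ι ℝ := Matrix.of fun i j => d i * Q i j * d j with hA
  have hAh : A.IsHermitian := by
    ext i j
    simp [hA, hQ j i]; ring
  set e := hAh.eigenvectorBasis with he
  set μ := hAh.eigenvalues with hμ
  have heig : ∀ k i, ∑ j, Q i j * (d j * e k j) = μ k * e k i / d i := by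
    intro k i
    have h := congrFun (hAh.mulVec_eigenvectorBasis k) i
    simp only [Matrix.mulVec, dotProduct, hA, Matrix.of_apply, Pi.smul_apply, smul_eq_mul] at h
    rw [eq_div_iff (hdpos i).ne', ← h, Finset.sum_mul]
    refine Finset.sum_congr rfl fun j _ => ?_
    ring
  have hnorm : ∀ k, ∑ i, e k i ^ 2 = 1 := by
    intro k
    have h := e.orthonormal.1 k
    have h2 := EuclideanSpace.norm_sq_eq (e k)
    rw [h] at h2
    simpa using h2.symm
  have hquad : ∀ k, ∑ i, ∑ j, (d i * e k i) * (Q i j * (d j * e k j)) = μ k := by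
    intro k
    simp_rw [← Finset.mul_sum, heig]
    trans μ k * ∑ i, e k i ^ 2
    swap
    · rw [hnorm, mul_one]
    rw [Finset.mul_sum]
    refine Finset.sum_congr rfl fun i _ => ?_
    have := (hdpos i).ne'
    field_simp
  -- `hbulk` on an eigenvector excludes eigenvalues strictly between 0 and 1.
  have hsq : ∀ k, μ k ≤ μ k ^ 2 := by
    intro k
    have h := hbulk (fun i => d i * e k i)
    rw [hquad] at h
    refine h.trans_eq ?_
    simp_rw [heig, ← hd2]
    rw [← mul_one (μ k ^ 2), ← hnorm k, Finset.mul_sum]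
    refine Finset.sum_congr rfl fun i _ => ?_
    have := (hdpos i).ne'
    field_simp
  -- A Dirichlet form: its nonnegativity bounds the eigenvalues by 1, and its vanishing makes d e /
  -- w constant along edges.
  have hone : ∀ k, 2 * (1 - μ k) =
      ∑ i, ∑ j, Q i j * w i * w j * (d i * e k i / w i - d j * e k j / w j) ^ 2 := by
    intro k
    rw [← Matrix.sum_div_mul_sq_sub_quadratic Q hQ w hw (fun i => d i * e k i), hquad, ← hnorm k]
    congr 2
    refine Finset.sum_congr rfl fun i _ => ?_
    rw [hpw, mul_pow, hd2]
    have := (hw i).ne'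
    have := (hp i).ne'
    field_simp
  have hterm : ∀ k i j, 0 ≤ Q i j * w i * w j * (d i * e k i / w i - d j * e k j / w j) ^ 2 :=
    fun k i j => mul_nonneg (mul_nonneg (mul_nonneg (hQ0 i j) (hw i).le) (hw j).le) (sq_nonneg _)
  have hle : ∀ k, μ k ≤ 1 := by
    intro k
    have := Finset.sum_nonneg fun i (_ : i ∈ Finset.univ) =>
      Finset.sum_nonneg fun j (_ : j ∈ Finset.univ) => hterm k i j
    rw [← hone] at this
    linarith
  set x : EuclideanSpace ℝ ι := WithLp.toLp 2 fun i => v i / d i with hx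
  -- A positive eigenvalue equals 1, and connectivity makes its eigenvector proportional to w/d;
  -- orthogonality to it is exactly ∑ pᵢ vᵢ = 0.
  have horth : ∀ k, 0 < μ k → inner ℝ (e k) x = 0 := by
    intro k hk
    have h1 : μ k = 1 := le_antisymm (hle k) (by nlinarith [hsq k])
    have h0 := hone k
    rw [h1, sub_self, mul_zero, eq_comm, Finset.sum_eq_zero_iff_of_nonneg
      (fun i _ => Finset.sum_nonneg fun j _ => hterm k i j)] at h0
    have hc : ∀ i j, d i * e k i / w i = d j * e k j / w j := by
      apply hconn (fun i => d i * e k i / w i)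
      intro i j hij
      have h2 := h0 i (Finset.mem_univ _)
      rw [Finset.sum_eq_zero_iff_of_nonneg (fun j _ => hterm k i j)] at h2
      have h3 := h2 j (Finset.mem_univ _)
      have h4 : Q i j * w i * w j ≠ 0 := (mul_pos (mul_pos hij (hw i)) (hw j)).ne'
      have h5 := pow_eq_zero_iff (two_ne_zero) |>.1 ((mul_eq_zero.1 h3).resolve_left h4)
      exact sub_eq_zero.1 h5
    rcases isEmpty_or_nonempty ι with hι | ⟨⟨i₀⟩⟩
    · simp [PiLp.inner_apply]
    · have h6 : inner ℝ (e k) x = (d i₀ * e k i₀ / w i₀) * ∑ i, p i * v i := by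
        rw [PiLp.inner_apply, Finset.mul_sum]
        refine Finset.sum_congr rfl fun i _ => ?_
        rw [← hc i i₀]
        have h7 := (hdpos i).ne'
        have h8 := (hw i).ne'
        have h9 : p i = w i / d i ^ 2 := by
          rw [hd2]; have := (hp i).ne'; field_simp
        rw [h9]
        simp only [hx, RCLike.inner_apply, conj_trivial]
        field_simp
      rw [h6, hv, mul_zero]
  have hexp : ∑ i, ∑ j, v i * (Q i j * v j) = ∑ k, μ k * inner ℝ (e k) x ^ 2 := by
    have h1 : ∀ i, x i = ∑ k, inner ℝ (e k) x * e k i := by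
      intro i
      conv_lhs => rw [← e.sum_repr' x]
      simp
    have h2 : ∀ j, v j = ∑ k, inner ℝ (e k) x * (d j * e k j) := by
      intro j
      have : v j = d j * x j := by
        simp only [hx]; have := (hdpos j).ne'; field_simp
      rw [this, h1, Finset.mul_sum]
      refine Finset.sum_congr rfl fun k _ => by ring
    have h3 : ∀ i, ∑ j, Q i j * v j = ∑ k, inner ℝ (e k) x * (μ k * e k i / d i) := by
      intro i
      simp_rw [← heig, Finset.mul_sum]
      rw [Finset.sum_comm]
      refine Finset.sum_congr rfl fun j _ => ?_
      conv_lhs => rw [h2 j]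
      rw [Finset.mul_sum]
      refine Finset.sum_congr rfl fun k _ => by ring
    simp_rw [← Finset.mul_sum, h3, Finset.mul_sum]
    rw [Finset.sum_comm]
    refine Finset.sum_congr rfl fun k _ => ?_
    have h4 : inner ℝ (e k) x = ∑ i, v i / d i * e k i := by
      simp [PiLp.inner_apply, hx]
    rw [sq, ← mul_assoc]
    nth_rewrite 3 [h4]
    rw [Finset.mul_sum]
    refine Finset.sum_congr rfl fun i _ => ?_
    ring
  rw [hexp]
  refine Finset.sum_nonpos fun k _ => ?_
  rcases le_or_gt (μ k) 0 with h | h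
  · exact mul_nonpos_of_nonpos_of_nonneg h (sq_nonneg _)
  · simp [horth k h]

end Matrix

/-! ### Mixed counts and mixed forms -/

noncomputable section

namespace Matroid

open scoped Classical in
/-- The elements that extend the independent set `I` to a larger independent set; these are the
nonloops of `M ／ I`. -/
def extFinset {α : Type*} (M : Matroid α) [M.Finite] (I : Finset α) : Finset α :=
  M.ground_finite.toFinset.filter fun x => x ∉ I ∧ M.Indep (insert x (I : Set α))

open scoped Classical in
/-- The mixed count of a list of weights `w₁, …, wₖ` above `I`: the sum of `∏ wᵢ xᵢ` over all
sequences `x₁, …, xₖ` of distinct elements outside `I` with `I ∪ {x₁, …, xₖ}` independent. For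
`k = r - |I|` it is the mixed directional derivative of the basis generating polynomial of
`M ／ I`. -/
def mixedCount {α : Type*} (M : Matroid α) [M.Finite] : List (α → ℝ) → Finset α → ℝ
  | [], _ => 1
  | w :: ws, I => ∑ x ∈ M.extFinset I, w x * M.mixedCount ws (insert x I)

section

open scoped Classical

variable {α : Type*} {M : Matroid α} [M.Finite] {I : Finset α} {x y : α}

theorem mem_extFinset : x ∈ M.extFinset I ↔ x ∉ I ∧ M.Indep (insert x (I : Set α)) := by
  simp only [extFinset, Finset.mem_filter, Set.Finite.mem_toFinset, and_iff_right_iff_imp]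
  exact fun h => h.2.subset_ground (Set.mem_insert _ _)

theorem indep_insert_of_mem_extFinset (hx : x ∈ M.extFinset I) :
    M.Indep ((insert x I : Finset α) : Set α) := by
  rw [Finset.coe_insert]; exact (mem_extFinset.1 hx).2

theorem card_insert_of_mem_extFinset (hx : x ∈ M.extFinset I) :
    (insert x I).card = I.card + 1 :=
  Finset.card_insert_of_notMem (mem_extFinset.1 hx).1

theorem mem_extFinset_and_comm :
    (x ∈ M.extFinset I ∧ y ∈ M.extFinset (insert x I)) ↔
      (y ∈ M.extFinset I ∧ x ∈ M.extFinset (insert y I)) := by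
  simp only [mem_extFinset, Finset.mem_insert, not_or, Finset.coe_insert]
  constructor
  · rintro ⟨⟨h1, h2⟩, ⟨h3, h4⟩, h5⟩
    exact ⟨⟨h4, h5.subset (Set.insert_subset_insert (Set.subset_insert _ _))⟩,
      ⟨Ne.symm h3, h1⟩, by rwa [Set.insert_comm]⟩
  · rintro ⟨⟨h1, h2⟩, ⟨h3, h4⟩, h5⟩
    exact ⟨⟨h4, h5.subset (Set.insert_subset_insert (Set.subset_insert _ _))⟩,
      ⟨Ne.symm h3, h1⟩, by rwa [Set.insert_comm]⟩

theorem mem_extFinset_iff_notMem_closure (hI : M.Indep (I : Set α)) :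
    x ∈ M.extFinset I ↔ x ∈ M.E \ M.closure I := by
  rw [mem_extFinset]
  constructor
  · rintro ⟨h1, h2⟩
    exact (hI.insert_indep_iff_of_notMem (by simpa using h1)).1 h2
  · intro h
    have h1 : x ∉ (I : Set α) := fun hx => h.2 (M.mem_closure_of_mem hx hI.subset_ground)
    exact ⟨by simpa using h1, (hI.insert_indep_iff_of_notMem h1).2 h⟩

/-- Two extensions of `I` extend it simultaneously iff they span different flats with `I`. -/
theorem mem_extFinset_insert_iff (hI : M.Indep (I : Set α)) (hx : x ∈ M.extFinset I) :
    y ∈ M.extFinset (insert x I) ↔ y ∈ M.extFinset I ∧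
      M.closure (insert x (I : Set α)) ≠ M.closure (insert y (I : Set α)) := by
  have hxI := indep_insert_of_mem_extFinset hx
  rw [mem_extFinset_iff_notMem_closure hxI, mem_extFinset_iff_notMem_closure hI,
    Finset.coe_insert]
  have hxE : x ∈ M.E := hxI.subset_ground (by simp)
  constructor
  · rintro ⟨h1, h2⟩
    refine ⟨⟨h1, fun h => h2 (M.closure_subset_closure (Set.subset_insert _ _) h)⟩, fun h => ?_⟩
    rw [h] at h2
    exact h2 (M.mem_closure_of_mem (Set.mem_insert _ _)
      (Set.insert_subset h1 hI.subset_ground))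
  · rintro ⟨⟨h1, h2⟩, h3⟩
    refine ⟨h1, fun h => h3 ?_⟩
    exact (M.closure_insert_congr ⟨h, h2⟩).symm

theorem extFinset_nonempty (hI : M.Indep (I : Set α)) (h : I.card < M.natRank) :
    (M.extFinset I).Nonempty := by
  obtain ⟨B, hB, hIB⟩ := hI.exists_isBase_superset
  have hne : (I : Set α) ≠ B := by
    rintro rfl
    rw [natRank, ← hB.encard_eq_eRank] at h
    simp at h
  obtain ⟨x, hxB, hxI⟩ := Set.exists_of_ssubset (hIB.ssubset_of_ne hne)
  exact ⟨x, mem_extFinset.2 ⟨by simpa using hxI, hB.indep.subset (Set.insert_subset hxB hIB)⟩⟩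

@[simp] theorem mixedCount_nil : M.mixedCount [] I = 1 := by
  rw [mixedCount]

theorem mixedCount_cons (w : α → ℝ) (ws : List (α → ℝ)) :
    M.mixedCount (w :: ws) I =
      ∑ x ∈ M.extFinset I, w x * M.mixedCount ws (insert x I) := by
  rw [mixedCount]

theorem mixedCount_perm {ws ws' : List (α → ℝ)} (h : ws.Perm ws') :
    M.mixedCount ws I = M.mixedCount ws' I := by
  induction h generalizing I with
  | nil => rfl
  | cons w _ ih => simp only [mixedCount_cons, ih]
  | trans _ _ ih1 ih2 => rw [ih1, ih2]
  | swap u v l =>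
    simp only [mixedCount_cons, Finset.mul_sum]
    rw [Finset.sum_comm' (t' := M.extFinset I) (s' := fun y => M.extFinset (insert y I))]
    · refine Finset.sum_congr rfl fun x _ => Finset.sum_congr rfl fun y _ => ?_
      rw [Finset.insert_comm]; ring
    · intro x y
      rw [mem_extFinset_and_comm, and_comm]

theorem mixedCount_swap (u v : α → ℝ) (ws : List (α → ℝ)) :
    M.mixedCount (u :: v :: ws) I = M.mixedCount (v :: u :: ws) I :=
  mixedCount_perm (List.Perm.swap _ _ _)

theorem mixedCount_rotate (u v w : α → ℝ) (ws : List (α → ℝ)) :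
    M.mixedCount (u :: v :: w :: ws) I = M.mixedCount (w :: u :: v :: ws) I :=
  mixedCount_perm (((List.Perm.swap w v ws).cons u).trans (List.Perm.swap w u (v :: ws)))

theorem mixedCount_add_cons (u v : α → ℝ) (ws : List (α → ℝ)) :
    M.mixedCount ((u + v) :: ws) I = M.mixedCount (u :: ws) I + M.mixedCount (v :: ws) I := by
  simp only [mixedCount_cons, Pi.add_apply, add_mul, Finset.sum_add_distrib]

theorem mixedCount_smul_cons (c : ℝ) (u : α → ℝ) (ws : List (α → ℝ)) :
    M.mixedCount ((c • u) :: ws) I = c * M.mixedCount (u :: ws) I := by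
  simp only [mixedCount_cons, Pi.smul_apply, smul_eq_mul, Finset.mul_sum, mul_assoc]

theorem mixedCount_single_cons (x : α) (ws : List (α → ℝ)) :
    M.mixedCount (Pi.single x 1 :: ws) I =
      if x ∈ M.extFinset I then M.mixedCount ws (insert x I) else 0 := by
  simp [mixedCount_cons, Pi.single_apply, ite_mul, Finset.sum_ite_eq']

theorem mixedCount_nonneg {ws : List (α → ℝ)} (h : ∀ w ∈ ws, ∀ x, 0 ≤ w x) :
    0 ≤ M.mixedCount ws I := by
  induction ws generalizing I with
  | nil => simp
  | cons w ws ih =>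
    rw [mixedCount_cons]
    simp only [List.mem_cons, forall_eq_or_imp] at h
    exact Finset.sum_nonneg fun x _ => mul_nonneg (h.1 x) (ih h.2)

theorem mixedCount_pos {ws : List (α → ℝ)} (h : ∀ w ∈ ws, ∀ x, 0 < w x)
    (hI : M.Indep (I : Set α)) (hcard : I.card + ws.length ≤ M.natRank) :
    0 < M.mixedCount ws I := by
  induction ws generalizing I with
  | nil => simp
  | cons w ws ih =>
    rw [mixedCount_cons]
    simp only [List.mem_cons, forall_eq_or_imp, List.length_cons] at h hcard
    refine Finset.sum_pos (fun x hx => mul_pos (h.1 x) ?_) (extFinset_nonempty hI (by omega))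
    exact ih h.2 (indep_insert_of_mem_extFinset hx)
      (by rw [card_insert_of_mem_extFinset hx]; omega)

/-- The symmetric bilinear form `(u, v) ↦ mixedCount (u :: v :: ws)`. -/
def mixedForm (M : Matroid α) [M.Finite] (ws : List (α → ℝ)) (I : Finset α) :
    LinearMap.BilinForm ℝ (α → ℝ) :=
  LinearMap.mk₂ ℝ (fun u v => M.mixedCount (u :: v :: ws) I)
    (fun _ _ _ => mixedCount_add_cons _ _ _)
    (fun _ _ _ => mixedCount_smul_cons _ _ _)
    (fun u v w => by
      rw [mixedCount_swap, mixedCount_add_cons, mixedCount_swap v, mixedCount_swap w])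
    (fun c u v => by
      rw [mixedCount_swap, mixedCount_smul_cons, mixedCount_swap v]; rfl)

theorem mixedForm_apply (ws : List (α → ℝ)) (u v : α → ℝ) :
    M.mixedForm ws I u v = M.mixedCount (u :: v :: ws) I := rfl

theorem mixedForm_comm (ws : List (α → ℝ)) (u v : α → ℝ) :
    M.mixedForm ws I u v = M.mixedForm ws I v u :=
  mixedCount_swap _ _ _

theorem mixedForm_self_nonneg {ws : List (α → ℝ)} (h : ∀ w ∈ ws, ∀ x, 0 ≤ w x) {u : α → ℝ}
    (hu : ∀ x, 0 ≤ u x) : 0 ≤ M.mixedForm ws I u u := by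
  refine mixedCount_nonneg fun w hw => ?_
  simp only [List.mem_cons, or_self_left] at hw
  rcases hw with rfl | hw
  exacts [hu, h w hw]

end

end Matroid

end

/-! ### Sums over the fibres of a map -/

section Fiber

variable {α β : Type*} [DecidableEq β]

theorem Finset.sum_inv_card_fiber_mul (N : Finset α) (κ : α → β) (f : β → ℝ) :
    ∑ x ∈ N, ((N.filter fun y => κ y = κ x).card : ℝ)⁻¹ * f (κ x) = ∑ c ∈ N.image κ, f c := by
  rw [← Finset.sum_fiberwise_of_maps_to (fun x hx => Finset.mem_image_of_mem κ hx)]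
  refine Finset.sum_congr rfl fun c hc => ?_
  have h1 : ∀ x ∈ N.filter fun y => κ y = c,
      ((N.filter fun y => κ y = κ x).card : ℝ)⁻¹ * f (κ x) =
        ((N.filter fun y => κ y = c).card : ℝ)⁻¹ * f c := by
    intro x hx
    rw [(Finset.mem_filter.1 hx).2]
  rw [Finset.sum_congr rfl h1, Finset.sum_const, nsmul_eq_mul, ← mul_assoc, mul_inv_cancel₀,
    one_mul]
  obtain ⟨x, hx, rfl⟩ := Finset.mem_image.1 hc
  exact Nat.cast_ne_zero.2 (Finset.card_ne_zero_of_mem (Finset.mem_filter.2 ⟨hx, rfl⟩))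

theorem Finset.sum_mul_sum_fiber (N : Finset α) (κ : α → β) (v : α → ℝ) :
    ∑ x ∈ N, v x * ∑ y ∈ N.filter (fun y => κ y = κ x), v y =
      ∑ c ∈ N.image κ, (∑ y ∈ N.filter (fun y => κ y = c), v y) ^ 2 := by
  rw [← Finset.sum_fiberwise_of_maps_to (fun x hx => Finset.mem_image_of_mem κ hx)]
  refine Finset.sum_congr rfl fun c _ => ?_
  rw [sq, Finset.sum_mul]
  refine Finset.sum_congr rfl fun x hx => ?_
  rw [(Finset.mem_filter.1 hx).2]

theorem Finset.sum_image_sub_sum_fiber (N : Finset α) (κ : α → β) (v : α → ℝ) :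
    ∑ c ∈ N.image κ, (∑ y ∈ N, v y - ∑ y ∈ N.filter (fun y => κ y = c), v y) =
      ((N.image κ).card - 1) * ∑ y ∈ N, v y := by
  rw [Finset.sum_sub_distrib, Finset.sum_const, nsmul_eq_mul,
    Finset.sum_fiberwise_of_maps_to (fun x hx => Finset.mem_image_of_mem κ hx)]
  ring

end Fiber

/-! ### Hyperbolicity of the mixed forms -/

noncomputable section

namespace Matroid

open scoped Classical

variable {α : Type*} {M : Matroid α} [M.Finite] {I : Finset α} {x y : α}

/-- The elements of `extFinset I` parallel to `x` in `M ／ I`. -/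
def extClass (M : Matroid α) [M.Finite] (I : Finset α) (x : α) : Finset α :=
  (M.extFinset I).filter fun y =>
    M.closure (insert y (I : Set α)) = M.closure (insert x (I : Set α))

theorem extFinset_insert (hI : M.Indep (I : Set α)) (hx : x ∈ M.extFinset I) :
    M.extFinset (insert x I) = M.extFinset I \ M.extClass I x := by
  ext y
  rw [mem_extFinset_insert_iff hI hx, extClass, Finset.mem_sdiff, Finset.mem_filter]
  tauto

theorem extFinset_insert_subset : M.extFinset (insert x I) ⊆ M.extFinset I := by
  intro y hy
  rw [mem_extFinset, Finset.coe_insert] at hy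
  rw [mem_extFinset]
  exact ⟨fun h => hy.1 (Finset.mem_insert_of_mem h),
    hy.2.subset (Set.insert_subset_insert (Set.subset_insert _ _))⟩

theorem sum_extFinset_insert (hI : M.Indep (I : Set α)) (hx : x ∈ M.extFinset I) (v : α → ℝ) :
    ∑ y ∈ M.extFinset (insert x I), v y =
      ∑ y ∈ M.extFinset I, v y - ∑ y ∈ M.extClass I x, v y := by
  rw [extFinset_insert hI hx, eq_sub_iff_add_eq]
  exact Finset.sum_sdiff (Finset.filter_subset _ _)

theorem mixedCount_pair (hI : M.Indep (I : Set α)) (u v : α → ℝ) :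
    M.mixedCount [u, v] I =
      ∑ x ∈ M.extFinset I, u x * (∑ y ∈ M.extFinset I, v y - ∑ y ∈ M.extClass I x, v y) := by
  rw [mixedCount_cons]
  refine Finset.sum_congr rfl fun x hx => ?_
  rw [← sum_extFinset_insert hI hx, mixedCount_cons]
  simp

theorem one_lt_card_image_closure (hI : M.Indep (I : Set α)) (hcard : I.card + 2 ≤ M.natRank) :
    1 < ((M.extFinset I).image fun y => M.closure (insert y (I : Set α))).card := by
  obtain ⟨x, hx⟩ := extFinset_nonempty hI (by omega)
  obtain ⟨y, hy⟩ := extFinset_nonempty (indep_insert_of_mem_extFinset hx)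
    (by rw [card_insert_of_mem_extFinset hx]; omega)
  have h := (mem_extFinset_insert_iff hI hx).1 hy
  exact Finset.one_lt_card.2
    ⟨_, Finset.mem_image_of_mem _ hx, _, Finset.mem_image_of_mem _ h.1, h.2⟩

/-- In rank two, `v` is in the radical of the form iff it sums to zero on parallel classes. -/
theorem mixedCount_pair_eq_zero_iff (hI : M.Indep (I : Set α)) (hcard : I.card + 2 ≤ M.natRank)
    (v : α → ℝ) :
    (∀ u, M.mixedCount [u, v] I = 0) ↔
      ∀ x ∈ M.extFinset I, ∑ y ∈ M.extClass I x, v y = 0 := by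
  constructor
  · intro h
    have h1 : ∀ x ∈ M.extFinset I,
        ∑ y ∈ M.extFinset I, v y - ∑ y ∈ M.extClass I x, v y = 0 := by
      intro x hx
      have h2 := h (Pi.single x 1)
      rw [mixedCount_single_cons, if_pos hx, mixedCount_cons] at h2
      rw [← sum_extFinset_insert hI hx]
      simpa using h2
    -- Summing over the k ≥ 2 classes gives (k - 1) ∑ v = 0, so the total vanishes, and with it each
    -- class sum.
    have h3 := Finset.sum_image_sub_sum_fiber (M.extFinset I)
      (fun y => M.closure (insert y (I : Set α))) v
    rw [Finset.sum_eq_zero] at h3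
    · have h4 := one_lt_card_image_closure hI hcard
      have h5 : (1 : ℝ) <
          ((M.extFinset I).image fun y => M.closure (insert y (I : Set α))).card := by
        exact_mod_cast h4
      have h6 : ∑ y ∈ M.extFinset I, v y = 0 :=
        (mul_eq_zero.1 h3.symm).resolve_left (by linarith)
      intro x hx
      have := h1 x hx
      rw [h6] at this
      linarith
    · intro c hc
      obtain ⟨x, hx, rfl⟩ := Finset.mem_image.1 hc
      exact h1 x hx
  · intro h u
    have h1 : ∑ y ∈ M.extFinset I, v y = 0 := by
      rw [← Finset.sum_fiberwise_of_maps_to (fun x hx => Finset.mem_image_of_mem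
        (fun y => M.closure (insert y (I : Set α))) hx)]
      refine Finset.sum_eq_zero fun c hc => ?_
      obtain ⟨x, hx, rfl⟩ := Finset.mem_image.1 hc
      exact h x hx
    rw [mixedCount_pair hI]
    refine Finset.sum_eq_zero fun x hx => ?_
    rw [h1, h x hx]
    simp

/-- In terms of class sums the form is (∑ u)(∑ v) - ∑ u(c) v(c). The test vector has all class sums
1, so orthogonality to it reads (k - 1) ∑ v = 0 with k ≥ 2 classes, and what remains of the form at
v is -∑ v(c)². -/
theorem mixedForm_nil_hyperbolic (hI : M.Indep (I : Set α)) (hcard : I.card + 2 ≤ M.natRank)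
    (u v : α → ℝ) (hu : 0 ≤ M.mixedForm [] I u u) :
    M.mixedForm [] I u u * M.mixedForm [] I v v ≤ M.mixedForm [] I u v ^ 2 := by
  refine LinearMap.BilinForm.mul_self_le_sq_of_nonpos_on_orthogonal _ (mixedForm_comm [])
    (fun x => ((M.extClass I x).card : ℝ)⁻¹) (fun v hv => ?_) u v hu
  have h5 : (1 : ℝ) <
      ((M.extFinset I).image fun y => M.closure (insert y (I : Set α))).card := by
    exact_mod_cast one_lt_card_image_closure hI hcard
  rw [mixedForm_apply, mixedCount_pair hI] at hv ⊢
  have h1 := Finset.sum_inv_card_fiber_mul (M.extFinset I)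
    (fun y => M.closure (insert y (I : Set α)))
    (fun c => ∑ y ∈ M.extFinset I, v y -
      ∑ y ∈ (M.extFinset I).filter (fun y => M.closure (insert y (I : Set α)) = c), v y)
  rw [Finset.sum_image_sub_sum_fiber] at h1
  have h2 : ∑ y ∈ M.extFinset I, v y = 0 :=
    (mul_eq_zero.1 (h1.symm.trans hv)).resolve_left (by linarith)
  have h3 := Finset.sum_mul_sum_fiber (M.extFinset I)
    (fun y => M.closure (insert y (I : Set α))) v
  simp only [h2, zero_sub, mul_neg, Finset.sum_neg_distrib, Left.neg_nonpos_iff]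
  exact (Finset.sum_nonneg fun c _ => sq_nonneg _).trans_eq h3.symm

/-- Induction on the weights. `Q` is the matrix of the form above `I`, its row sums against `w` are
the values at (w, w) of the forms above `I ∪ {i}`, and the induction hypothesis for those forms
supplies the spectral bound. -/
theorem mixedForm_hyperbolic_of_pos (ws : List (α → ℝ)) (hws : ∀ w ∈ ws, ∀ x, 0 < w x)
    (hI : M.Indep (I : Set α)) (hcard : I.card + ws.length + 2 ≤ M.natRank)
    (u v : α → ℝ) (hu : 0 ≤ M.mixedForm ws I u u) :
    M.mixedForm ws I u u * M.mixedForm ws I v v ≤ M.mixedForm ws I u v ^ 2 := by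
  induction ws generalizing I u v with
  | nil => exact mixedForm_nil_hyperbolic hI (by simpa using hcard) u v hu
  | cons w ws ih =>
    simp only [List.mem_cons, forall_eq_or_imp, List.length_cons] at hws hcard
    have hwws : ∀ f ∈ w :: ws, ∀ x, 0 < f x := by simpa using hws
    refine LinearMap.BilinForm.mul_self_le_sq_of_nonpos_on_orthogonal _ (mixedForm_comm _)
      w (fun v hv => ?_) u v hu
    let Q : Matrix (M.extFinset I) (M.extFinset I) ℝ := Matrix.of fun i j =>
      if (j : α) ∈ M.extFinset (insert (i : α) I) then
        M.mixedCount (w :: ws) (insert (j : α) (insert (i : α) I)) else 0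
    have hQ : ∀ i j, Q i j = Q j i := by
      intro i j
      have h := mem_extFinset_and_comm (M := M) (I := I) (x := (i : α)) (y := (j : α))
      simp only [i.2, j.2, true_and] at h
      simp only [Q, Matrix.of_apply, h, Finset.insert_comm (i : α) (j : α)]
    have hcount : ∀ i j : M.extFinset I, (j : α) ∈ M.extFinset (insert (i : α) I) →
        0 < M.mixedCount (w :: ws) (insert (j : α) (insert (i : α) I)) := by
      intro i j h
      refine mixedCount_pos hwws (indep_insert_of_mem_extFinset h) ?_
      rw [card_insert_of_mem_extFinset h, card_insert_of_mem_extFinset i.2, List.length_cons]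
      omega
    have hQv : ∀ (f : α → ℝ) (i : M.extFinset I),
        ∑ j, Q i j * f j = M.mixedCount (f :: w :: ws) (insert (i : α) I) := by
      intro f i
      rw [mixedCount_cons, Finset.univ_eq_attach]
      simp only [Q, Matrix.of_apply]
      rw [Finset.sum_attach (M.extFinset I) (fun j => (if j ∈ M.extFinset (insert (i : α) I) then
        M.mixedCount (w :: ws) (insert j (insert (i : α) I)) else 0) * f j)]
      simp only [ite_mul, zero_mul]
      rw [← Finset.sum_filter, Finset.filter_mem_eq_inter,
        Finset.inter_eq_right.2 extFinset_insert_subset]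
      exact Finset.sum_congr rfl fun j _ => mul_comm _ _
    have hquad : ∀ f : α → ℝ, ∑ i : M.extFinset I, ∑ j, f i * (Q i j * f j) =
        M.mixedCount (f :: f :: w :: ws) I := by
      intro f
      simp only [← Finset.mul_sum, hQv]
      rw [mixedCount_cons, Finset.univ_eq_attach, Finset.sum_attach (M.extFinset I)
        (fun i => f i * M.mixedCount (f :: w :: ws) (insert i I))]
    have hp : ∀ i : M.extFinset I, 0 < M.mixedCount (w :: w :: ws) (insert (i : α) I) := by
      intro i
      refine mixedCount_pos (by simpa using hws) (indep_insert_of_mem_extFinset i.2) ?_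
      rw [card_insert_of_mem_extFinset i.2, List.length_cons, List.length_cons]
      omega
    rw [mixedForm_apply, ← hquad]
    refine Matrix.quadratic_nonpos_of_orthogonal Q hQ ?_ (fun i => w i)
      (fun i => M.mixedCount (w :: w :: ws) (insert (i : α) I)) (fun i => hws.1 i) hp
      (fun i => hQv w i) ?_ ?_ (fun i => v i) ?_
    · intro i j
      simp only [Q, Matrix.of_apply]
      split_ifs with h
      exacts [(hcount i j h).le, le_rfl]
    -- Non-parallel elements are adjacent; parallel ones share a neighbour because the rank above
    -- `I` exceeds one.
    · intro z hz i j
      have hadj : ∀ i j : M.extFinset I, M.closure (insert (i : α) (I : Set α)) ≠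
          M.closure (insert (j : α) (I : Set α)) → z i = z j := by
        intro i j hij
        have h := (mem_extFinset_insert_iff hI i.2).2 ⟨j.2, hij⟩
        apply hz
        simp only [Q, Matrix.of_apply, if_pos h]
        exact hcount i j h
      by_cases hij : M.closure (insert (i : α) (I : Set α)) =
          M.closure (insert (j : α) (I : Set α))
      · obtain ⟨k, hk⟩ := extFinset_nonempty (indep_insert_of_mem_extFinset i.2)
          (by rw [card_insert_of_mem_extFinset i.2]; omega)
        have h := (mem_extFinset_insert_iff hI i.2).1 hk
        rw [hadj i ⟨k, h.1⟩ h.2, hadj j ⟨k, h.1⟩ (hij ▸ h.2)]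
      · exact hadj i j hij
    -- Pulling `w` to the front writes the form at `f` as ∑ wᵢ Bᵢ(f, f), with Bᵢ the form above `I ∪
    -- {i}`. Reversed Cauchy–Schwarz bounds Bᵢ(f, f) by Bᵢ(w, f)² / Bᵢ(w, w) = (Q f)ᵢ² / pᵢ.
    · intro f
      let f' : α → ℝ := fun x => if h : x ∈ M.extFinset I then f ⟨x, h⟩ else 0
      have hf : f = fun i : M.extFinset I => f' i := by
        ext i
        simp [f']
      rw [hf, hquad]
      simp only [hQv]
      rw [mixedCount_rotate, mixedCount_cons, ← Finset.sum_attach, Finset.univ_eq_attach]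
      refine Finset.sum_le_sum fun i _ => ?_
      have h := ih hws.2 (indep_insert_of_mem_extFinset i.2)
        (by rw [card_insert_of_mem_extFinset i.2]; omega) w f' (hp i).le
      simp only [mixedForm_apply] at h
      rw [div_mul_eq_mul_div, mul_div_assoc]
      refine mul_le_mul_of_nonneg_left ?_ (hws.1 i).le
      rw [le_div_iff₀ (hp i), mul_comm, mixedCount_swap f' w]
      exact h
    · rw [mixedForm_comm, mixedForm_apply, mixedCount_cons] at hv
      rw [Finset.univ_eq_attach, Finset.sum_attach (M.extFinset I)
        (fun i => M.mixedCount (w :: w :: ws) (insert i I) * v i)]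
      rw [← hv]
      exact Finset.sum_congr rfl fun _ _ => mul_comm _ _

theorem continuous_mixedCount_add_const (ws : List (α → ℝ)) :
    Continuous fun ε : ℝ => M.mixedCount (ws.map fun w x => w x + ε) I := by
  induction ws generalizing I with
  | nil => simpa using continuous_const
  | cons w ws ih =>
    simp only [List.map_cons, mixedCount_cons]
    exact continuous_finsetSum _ fun x _ => (continuous_const.add continuous_id).mul ih

/-- The mixed forms of a matroid with nonnegative weights are hyperbolic. -/
theorem mixedForm_hyperbolic {ws : List (α → ℝ)} (hws : ∀ w ∈ ws, ∀ x, 0 ≤ w x)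
    (hI : M.Indep (I : Set α)) (hcard : I.card + ws.length + 2 ≤ M.natRank)
    {u : α → ℝ} (hu : ∀ x, 0 ≤ u x) (v : α → ℝ) :
    M.mixedForm ws I u u * M.mixedForm ws I v v ≤ M.mixedForm ws I u v ^ 2 := by
  have hcont : ∀ f g : α → ℝ, Continuous fun ε : ℝ =>
      M.mixedForm (ws.map fun w x => w x + ε) I f g := by
    intro f g
    simp only [mixedForm_apply, mixedCount_cons]
    exact continuous_finsetSum _ fun x _ => continuous_const.mul
      (continuous_finsetSum _ fun y _ => continuous_const.mul
        (continuous_mixedCount_add_const ws))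
  have h0 : ws.map (fun w x => w x + (0 : ℝ)) = ws := by simp
  -- Perturb the weights to be positive and let ε tend to 0. Nonnegativity of `u` keeps the value at
  -- (u, u) nonnegative for every ε.
  have key : ∀ ε ∈ Set.Ioi (0 : ℝ),
      M.mixedForm (ws.map fun w x => w x + ε) I u u *
        M.mixedForm (ws.map fun w x => w x + ε) I v v ≤
      M.mixedForm (ws.map fun w x => w x + ε) I u v ^ 2 := by
    intro ε hε
    have hpos : ∀ w ∈ ws.map fun w x => w x + ε, ∀ x, 0 < w x := by
      intro w hw x
      obtain ⟨w', hw', rfl⟩ := List.mem_map.1 hw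
      exact add_pos_of_nonneg_of_pos (hws w' hw' x) hε
    exact mixedForm_hyperbolic_of_pos _ hpos hI (by simpa using hcard) u v
      (mixedForm_self_nonneg (fun w hw x => (hpos w hw x).le) hu)
  have hcl : (0 : ℝ) ∈ _root_.closure (Set.Ioi (0 : ℝ)) := by simp
  have h := le_on_closure key ((hcont u u).mul (hcont v v)).continuousOn
    ((hcont u v).pow 2).continuousOn hcl
  simpa only [h0] using h

end Matroid

end

/-! ### Descent of the radical -/

noncomputable section

namespace Matroid

open scoped Classical

variable {α : Type*} {M : Matroid α} [M.Finite] {I : Finset α} {x y : α}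

/-- If the mixed counts of `ρ, ρ` and `ρ, σ` above `I ∪ {j}` vanish, so does that of `σ, σ`. -/
theorem mixedCount_insert_eq_zero {L : List (α → ℝ)} (hL : ∀ w ∈ L, ∀ x, 0 ≤ w x)
    (hI : M.Indep (I : Set α)) (hcard : I.card + L.length + 3 ≤ M.natRank)
    {ρ σ : α → ℝ} (hρ : ∀ x, 0 ≤ ρ x) (hσ : ∀ x, 0 ≤ σ x)
    (hpos : 0 < M.mixedCount (ρ :: σ :: ρ :: L) I) {j : α} (hj : j ∈ M.extFinset I)
    (h : M.mixedCount (ρ :: σ :: L) (insert j I) = 0) :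
    M.mixedCount (σ :: σ :: L) (insert j I) = 0 := by
  have hσL : ∀ w ∈ σ :: L, ∀ x, 0 ≤ w x := by
    simpa using ⟨hσ, hL⟩
  -- The unit vector at `j` is null, since `j` cannot be added twice, and is orthogonal to `ρ` by
  -- `h`. It therefore lies in the radical; pair it with `σ`.
  have h1 := LinearMap.BilinForm.eq_zero_of_isotropic_of_orthogonal (M.mixedForm (σ :: L) I)
    (mixedForm_comm _) ρ (by
      rw [mixedForm_apply, mixedCount_perm ((List.Perm.swap σ ρ L).cons ρ)]; exact hpos)
    (mixedForm_hyperbolic hσL hI (by simpa [add_assoc] using hcard) hρ) (Pi.single j 1)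
    (by rw [mixedForm_comm, mixedForm_apply, mixedCount_single_cons, if_pos hj, h])
    (by
      rw [mixedForm_apply, mixedCount_single_cons, if_pos hj, mixedCount_single_cons, if_neg]
      simp [mem_extFinset]) σ
  rwa [mixedForm_comm, mixedForm_apply, mixedCount_single_cons, if_pos hj] at h1

/-- A vector `ρ - s σ` in the radical of the form with weights `ρ :: L` above `I` lies in the
radical of the form with weights `L` above `I ∪ {i}`, for `i` in the support of `ρ`. -/
theorem mixedCount_radical_insert {L : List (α → ℝ)} (hL : ∀ w ∈ L, ∀ x, 0 ≤ w x)
    (hI : M.Indep (I : Set α)) (hcard : I.card + L.length + 3 ≤ M.natRank)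
    {ρ σ : α → ℝ} (hρ : ∀ x, 0 ≤ ρ x) (hσ : ∀ x, 0 ≤ σ x) {s : ℝ} (hs : 0 < s)
    (hrad : ∀ u, M.mixedCount (u :: (ρ - s • σ) :: ρ :: L) I = 0)
    (hpos : 0 < M.mixedCount (ρ :: σ :: ρ :: L) I) {i : α} (hi : i ∈ M.extFinset I)
    (hρi : 0 < ρ i) (hone : 0 < M.mixedCount ((ρ + σ) :: (ρ + σ) :: L) (insert i I)) :
    (∀ u, M.mixedCount (u :: (ρ - s • σ) :: L) (insert i I) = 0) ∧
      0 < M.mixedCount (ρ :: σ :: L) (insert i I) := by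
  have hform : ∀ j ∈ M.extFinset I, M.mixedForm L (insert j I) ρ (ρ - s • σ) = 0 := by
    intro j hj
    have h := hrad (Pi.single j 1)
    rw [mixedCount_single_cons, if_pos hj] at h
    rw [mixedForm_comm]
    exact h
  have hrel : ∀ j ∈ M.extFinset I, M.mixedForm L (insert j I) ρ ρ =
      s * M.mixedForm L (insert j I) ρ σ := by
    intro j hj
    have h := hform j hj
    simp only [map_sub, map_smul, smul_eq_mul] at h
    linarith
  have hhyp : ∀ j ∈ M.extFinset I, ∀ v, M.mixedForm L (insert j I) ρ ρ *
      M.mixedForm L (insert j I) v v ≤ M.mixedForm L (insert j I) ρ v ^ 2 := fun j hj v =>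
    mixedForm_hyperbolic hL (indep_insert_of_mem_extFinset hj)
      (by rw [card_insert_of_mem_extFinset hj]; omega) hρ v
  -- Degenerate case: the form above `I ∪ {j}` then vanishes on the whole span of `ρ` and `σ`.
  have hzero : ∀ j ∈ M.extFinset I, M.mixedForm L (insert j I) ρ ρ = 0 →
      M.mixedForm L (insert j I) ρ σ = 0 ∧ M.mixedForm L (insert j I) σ σ = 0 := by
    intro j hj h
    have h1 := hrel j hj
    rw [h] at h1
    have h2 : M.mixedForm L (insert j I) ρ σ = 0 :=
      (mul_eq_zero.1 h1.symm).resolve_left hs.ne'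
    exact ⟨h2, mixedCount_insert_eq_zero hL hI hcard hρ hσ hpos hj h2⟩
  have hnonpos : ∀ j ∈ M.extFinset I,
      M.mixedForm L (insert j I) (ρ - s • σ) (ρ - s • σ) ≤ 0 := by
    intro j hj
    rcases (mixedForm_self_nonneg (M := M) (I := insert j I) hL hρ).eq_or_lt with h | h
    · obtain ⟨h1, h2⟩ := hzero j hj h.symm
      have h3 : M.mixedForm L (insert j I) σ ρ = 0 := by rw [mixedForm_comm, h1]
      simp [h1, h2, h3, ← h]
    · have h1 := hhyp j hj (ρ - s • σ)
      rw [hform j hj] at h1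
      by_contra! h2
      have := mul_pos h h2
      linarith
  -- A sum of nonpositive terms that is zero, so the term at `i`, whose weight is positive,
  -- vanishes.
  have hsum : ∑ j ∈ M.extFinset I,
      ρ j * M.mixedForm L (insert j I) (ρ - s • σ) (ρ - s • σ) = 0 := by
    have h := hrad (ρ - s • σ)
    rwa [mixedCount_rotate, mixedCount_cons] at h
  have hi0 : M.mixedForm L (insert i I) (ρ - s • σ) (ρ - s • σ) = 0 := by
    have h := (Finset.sum_eq_zero_iff_of_nonpos fun j hj =>
      mul_nonpos_of_nonneg_of_nonpos (hρ j) (hnonpos j hj)).1 hsum i hi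
    exact (mul_eq_zero.1 h).resolve_left hρi.ne'
  have hii : 0 < M.mixedForm L (insert i I) ρ ρ := by
    refine lt_of_le_of_ne (mixedForm_self_nonneg hL hρ) fun h => ?_
    obtain ⟨h1, h2⟩ := hzero i hi h.symm
    have h3 : M.mixedForm L (insert i I) σ ρ = 0 := by rw [mixedForm_comm, h1]
    rw [← mixedForm_apply] at hone
    simp [h1, h2, h3, ← h] at hone
  refine ⟨fun u => LinearMap.BilinForm.eq_zero_of_isotropic_of_orthogonal
    (M.mixedForm L (insert i I)) (mixedForm_comm _) ρ hii (hhyp i hi) _ (hform i hi) hi0 u, ?_⟩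
  rw [hrel i hi] at hii
  exact pos_of_mul_pos_right hii hs.le

/-- `A` is obtained from `I` by adding one element in the support of each weight of the list,
staying independent. -/
inductive Reaches (M : Matroid α) [M.Finite] : Finset α → List (α → ℝ) → Finset α → Prop
  | nil (I : Finset α) : Reaches M I [] I
  | cons {I A : Finset α} {w : α → ℝ} {ws : List (α → ℝ)} {x : α} (hx : x ∈ M.extFinset I)
      (hw : 0 < w x) (h : Reaches M (insert x I) ws A) : Reaches M I (w :: ws) A

theorem Reaches.indep {ws : List (α → ℝ)} {A : Finset α} (h : M.Reaches I ws A)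
    (hI : M.Indep (I : Set α)) : M.Indep (A : Set α) := by
  induction h with
  | nil => exact hI
  | cons hx _ _ ih => exact ih (indep_insert_of_mem_extFinset hx)

theorem Reaches.card_eq {ws : List (α → ℝ)} {A : Finset α} (h : M.Reaches I ws A) :
    A.card = I.card + ws.length := by
  induction h with
  | nil => simp
  | cons hx _ _ ih =>
    rw [ih, card_insert_of_mem_extFinset hx, List.length_cons]
    omega

theorem Reaches.mixedCount_append_pos {ws ws' : List (α → ℝ)} {A : Finset α}
    (h : M.Reaches I ws A) (hws : ∀ w ∈ ws, ∀ x, 0 ≤ w x) (hws' : ∀ w ∈ ws', ∀ x, 0 ≤ w x)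
    (hA : 0 < M.mixedCount ws' A) : 0 < M.mixedCount (ws ++ ws') I := by
  induction h with
  | nil => simpa using hA
  | @cons I A w ws x hx hw h ih =>
    simp only [List.mem_cons, forall_eq_or_imp] at hws
    rw [List.cons_append, mixedCount_cons]
    refine Finset.sum_pos' (fun y _ => mul_nonneg (hws.1 y) (mixedCount_nonneg ?_))
      ⟨x, hx, mul_pos hw (ih hws.2 hA)⟩
    intro f hf
    rcases List.mem_append.1 hf with hf | hf
    exacts [hws.2 f hf, hws' f hf]

theorem mixedCount_append_eq_zero {ws ws' : List (α → ℝ)} (hws : ∀ w ∈ ws, ∀ x, 0 ≤ w x)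
    (h : ∀ A, M.Reaches I ws A → M.mixedCount ws' A = 0) :
    M.mixedCount (ws ++ ws') I = 0 := by
  induction ws generalizing I with
  | nil => simpa using h I (Reaches.nil I)
  | cons w ws ih =>
    simp only [List.mem_cons, forall_eq_or_imp] at hws
    rw [List.cons_append, mixedCount_cons]
    refine Finset.sum_eq_zero fun x hx => ?_
    rcases (hws.1 x).eq_or_lt with h0 | h0
    · rw [← h0, zero_mul]
    · rw [ih hws.2 fun A hA => h A (hA.cons hx h0), mul_zero]

/-- A vector `ρ - s σ` in the radical of the form above `I` with weights among `ρ`, `σ` lies in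
the radical of each of the rank two forms that this form is composed of. -/
theorem Reaches.radical {ρ σ : α → ℝ} (hρ : ∀ x, 0 ≤ ρ x) (hσ : ∀ x, 0 ≤ σ x)
    (hρσ : ∀ x, 0 < ρ x + σ x) {s : ℝ} (hs : 0 < s) {ws : List (α → ℝ)} {A : Finset α}
    (h : M.Reaches I ws A) (hws : ∀ w ∈ ws, w = ρ ∨ w = σ) (hI : M.Indep (I : Set α))
    (hcard : I.card + ws.length + 2 ≤ M.natRank)
    (hrad : ∀ u, M.mixedCount (u :: (ρ - s • σ) :: ws) I = 0)
    (hpos : 0 < M.mixedCount (ρ :: σ :: ws) I) (u : α → ℝ) :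
    M.mixedCount [u, ρ - s • σ] A = 0 := by
  induction h with
  | nil => exact hrad u
  | @cons I A w ws x hx hw h ih =>
    simp only [List.mem_cons, forall_eq_or_imp, List.length_cons] at hws hcard
    have hL : ∀ w ∈ ws, ∀ x, 0 ≤ w x := by
      intro w hw
      rcases hws.2 w hw with rfl | rfl
      exacts [hρ, hσ]
    have hxI := indep_insert_of_mem_extFinset hx
    have hc := card_insert_of_mem_extFinset hx
    -- `ρ + σ` is positive everywhere, so one path to `A` followed by two arbitrary extensions
    -- already contributes.
    have hone : 0 < M.mixedCount ((ρ + σ) :: (ρ + σ) :: ws) (insert x I) := by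
      have hpair : ∀ w ∈ [ρ + σ, ρ + σ], ∀ x, 0 < w x := by simpa using hρσ
      have h1 := h.mixedCount_append_pos (ws' := [ρ + σ, ρ + σ]) hL
        (fun w hw x => (hpair w hw x).le)
        (mixedCount_pos hpair (h.indep hxI) (by rw [h.card_eq, hc]; simp; omega))
      rw [mixedCount_perm List.perm_append_comm] at h1
      exact h1
    have key : (∀ u, M.mixedCount (u :: (ρ - s • σ) :: ws) (insert x I) = 0) ∧
        0 < M.mixedCount (ρ :: σ :: ws) (insert x I) := by
      rcases hws.1 with rfl | rfl
      · exact mixedCount_radical_insert hL hI (by omega) hρ hσ hs hrad hpos hx hw hone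
      -- Here `w` is the former `σ`: exchange the two weights and replace `s` by its inverse, which
      -- only rescales the radical vector.
      · have hv : w - s⁻¹ • ρ = (-s⁻¹) • (ρ - s • w) := by
          ext y
          simp only [Pi.sub_apply, Pi.smul_apply, smul_eq_mul]
          field_simp
          ring
        have h1 := mixedCount_radical_insert hL hI (by omega) hσ hρ (inv_pos.2 hs)
          (fun u => by
            rw [hv, mixedCount_swap, mixedCount_smul_cons, mixedCount_swap, hrad, mul_zero])
          (by rw [mixedCount_swap]; exact hpos) hx hw (by rw [add_comm w ρ]; exact hone)
        refine ⟨fun u => ?_, by rw [mixedCount_swap]; exact h1.2⟩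
        have h2 := h1.1 u
        rw [hv, mixedCount_swap, mixedCount_smul_cons, mixedCount_swap] at h2
        exact (mul_eq_zero.1 h2).resolve_left (neg_ne_zero.2 (inv_ne_zero hs.ne'))
    exact ih hws.2 hxI (by rw [hc]; omega) key.1 key.2

end Matroid

end

/-! ### Indicator weights and counting bases -/

noncomputable section

namespace Matroid

theorem IsBase.card_eq_natRank {α : Type*} {M : Matroid α} {B : Finset α} (hB : M.IsBase (B : Set α)) :
    B.card = M.natRank := by
  rw [natRank, ← hB.encard_eq_eRank]
  simp

open scoped Classical

variable {α : Type*} {M : Matroid α} [M.Finite] {I : Finset α} {x y : α} {R : Set α}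

/-- The list of `b` copies of the indicator of `R` and `c` copies of that of its complement. -/
def indicatorList (R : Set α) (b c : ℕ) : List (α → ℝ) :=
  List.replicate b (R.indicator 1) ++ List.replicate c (Rᶜ.indicator 1)

theorem indicator_one_nonneg (S : Set α) (x : α) : (0 : ℝ) ≤ S.indicator 1 x :=
  Set.indicator_nonneg (fun _ _ => zero_le_one) x

theorem mem_indicatorList {b c : ℕ} {w : α → ℝ} (hw : w ∈ indicatorList R b c) :
    w = R.indicator 1 ∨ w = Rᶜ.indicator 1 :=
  (List.mem_append.1 hw).imp List.eq_of_mem_replicate List.eq_of_mem_replicate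

theorem indicatorList_nonneg {b c : ℕ} : ∀ w ∈ indicatorList R b c, ∀ x, 0 ≤ w x := by
  intro w hw
  rcases mem_indicatorList hw with rfl | rfl <;> exact indicator_one_nonneg _

theorem length_indicatorList {b c : ℕ} : (indicatorList R b c).length = b + c := by
  simp [indicatorList]

theorem indicatorList_succ_left (b c : ℕ) :
    indicatorList R (b + 1) c = R.indicator 1 :: indicatorList R b c := rfl

theorem indicatorList_zero_succ (c : ℕ) :
    indicatorList R 0 (c + 1) = Rᶜ.indicator 1 :: indicatorList R 0 c := rfl

theorem indicatorList_succ_right_perm (b c : ℕ) :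
    (indicatorList R b (c + 1)).Perm (Rᶜ.indicator 1 :: indicatorList R b c) :=
  List.perm_middle

theorem Reaches.card_filter {b c : ℕ} {A : Finset α} (h : M.Reaches I (indicatorList R b c) A) :
    (A.filter (· ∈ R)).card = (I.filter (· ∈ R)).card + b := by
  induction b generalizing I with
  | zero =>
    induction c generalizing I with
    | zero => cases h; simp
    | succ c ih =>
      rw [indicatorList_zero_succ] at h
      cases h with
      | @cons _ _ _ _ x hx hw h =>
        have hxR : x ∉ R := fun hR => by simp [hR] at hw
        rw [ih h, Finset.filter_insert, if_neg hxR]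
  | succ b ih =>
    rw [indicatorList_succ_left] at h
    cases h with
    | @cons _ _ _ _ x hx hw h =>
      have hxR : x ∈ R := by
        by_contra hR
        simp [hR] at hw
      rw [ih h, Finset.filter_insert, if_pos hxR, Finset.card_insert_of_notMem]
      · omega
      · simp [(mem_extFinset.1 hx).1]

theorem reaches_indicatorList {b c : ℕ} {A : Finset α} (hA : M.Indep (A : Set α)) (hIA : I ⊆ A)
    (hb : ((A \ I).filter (· ∈ R)).card = b) (hc : ((A \ I).filter (· ∉ R)).card = c) :
    M.Reaches I (indicatorList R b c) A := by
  have hext : ∀ J : Finset α, J ⊆ A → ∀ x ∈ A \ J, x ∈ M.extFinset J := by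
    intro J hJ x hx
    rw [Finset.mem_sdiff] at hx
    exact mem_extFinset.2 ⟨hx.2, hA.subset (Set.insert_subset (by simpa using hx.1)
      (by simpa using hJ))⟩
  induction b generalizing I with
  | zero =>
    induction c generalizing I with
    | zero =>
      have h : A \ I = ∅ := by
        rw [← Finset.card_eq_zero, ← Finset.card_filter_add_card_filter_not (s := A \ I) (· ∈ R),
          hb, hc]
      rw [Finset.sdiff_eq_empty_iff_subset] at h
      rw [hIA.antisymm h]
      exact Reaches.nil A
    | succ c ih =>
      obtain ⟨x, hx⟩ := Finset.card_pos.1 (by rw [hc]; exact Nat.succ_pos c)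
      have hx' := Finset.mem_filter.1 hx
      rw [indicatorList_zero_succ]
      refine Reaches.cons (hext I hIA x hx'.1) (by simp [hx'.2]) (ih ?_ ?_ ?_)
      · exact Finset.insert_subset (Finset.mem_sdiff.1 hx'.1).1 hIA
      · rw [Finset.sdiff_insert, Finset.filter_erase, Finset.erase_eq_of_notMem, hb]
        simp [hx'.2]
      · rw [Finset.sdiff_insert, Finset.filter_erase, Finset.card_erase_of_mem hx, hc]
        rfl
  | succ b ih =>
    obtain ⟨x, hx⟩ := Finset.card_pos.1 (by rw [hb]; exact Nat.succ_pos b)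
    have hx' := Finset.mem_filter.1 hx
    rw [indicatorList_succ_left]
    refine Reaches.cons (hext I hIA x hx'.1) (by simp [hx'.2]) (ih ?_ ?_ ?_)
    · exact Finset.insert_subset (Finset.mem_sdiff.1 hx'.1).1 hIA
    · rw [Finset.sdiff_insert, Finset.filter_erase, Finset.card_erase_of_mem hx, hb]
      rfl
    · rw [Finset.sdiff_insert, Finset.filter_erase, Finset.erase_eq_of_notMem, hc]
      simp [hx'.2]

/-- The bases that contain `I` and have exactly `b` elements of `R` outside `I`. -/
def basesAbove (M : Matroid α) [M.Finite] (R : Set α) (I : Finset α) (b : ℕ) :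
    Finset (Finset α) :=
  M.ground_finite.toFinset.powerset.filter fun B =>
    M.IsBase (B : Set α) ∧ I ⊆ B ∧ ((B \ I).filter (· ∈ R)).card = b

theorem mem_basesAbove {b : ℕ} {B : Finset α} : B ∈ M.basesAbove R I b ↔
    M.IsBase (B : Set α) ∧ I ⊆ B ∧ ((B \ I).filter (· ∈ R)).card = b := by
  rw [basesAbove, Finset.mem_filter, Finset.mem_powerset, and_iff_right_iff_imp]
  intro h x hx
  simpa using h.1.subset_ground hx

/-- Double counting of pairs (x, B) with x in B \ I and in R. -/
theorem sum_card_basesAbove_insert_of_mem (b : ℕ) :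
    ∑ x ∈ (M.extFinset I).filter (· ∈ R), (M.basesAbove R (insert x I) b).card =
      (b + 1) * (M.basesAbove R I (b + 1)).card := by
  simp only [Finset.card_eq_sum_ones (M.basesAbove R _ b)]
  rw [Finset.sum_comm' (t' := M.basesAbove R I (b + 1))
    (s' := fun B => (B \ I).filter (· ∈ R))]
  · simp only [← Finset.card_eq_sum_ones]
    rw [Finset.sum_congr rfl fun B hB => (mem_basesAbove.1 hB).2.2, Finset.sum_const, smul_eq_mul,
      mul_comm]
  · intro x B
    simp only [mem_basesAbove, Finset.mem_filter, Finset.mem_sdiff, mem_extFinset,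
      Finset.insert_subset_iff]
    constructor
    · rintro ⟨⟨⟨h1, h2⟩, h3⟩, h4, ⟨h5, h6⟩, h7⟩
      refine ⟨⟨⟨h5, h1⟩, h3⟩, h4, h6, ?_⟩
      rw [← h7, Finset.sdiff_insert, Finset.filter_erase, Finset.card_erase_add_one]
      simp [h1, h3, h5]
    · rintro ⟨⟨⟨h1, h2⟩, h3⟩, h4, h5, h6⟩
      refine ⟨⟨⟨h2, h4.indep.subset (Set.insert_subset (by simpa using h1)
        (by simpa using h5))⟩, h3⟩, h4, ⟨h1, h5⟩, ?_⟩
      rw [Finset.sdiff_insert, Finset.filter_erase, Finset.card_erase_of_mem, h6]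
      · rfl
      · simp [h1, h2, h3]

/-- The same double counting outside R, where the number of choices of x in B is known only through
the rank. The case of no further R-elements suffices, since `indicatorList` lists the copies for R
first. -/
theorem sum_card_basesAbove_insert_of_notMem {c : ℕ} (hcard : I.card + (c + 1) = M.natRank) :
    ∑ x ∈ (M.extFinset I).filter (· ∉ R), (M.basesAbove R (insert x I) 0).card =
      (c + 1) * (M.basesAbove R I 0).card := by
  simp only [Finset.card_eq_sum_ones (M.basesAbove R _ 0)]
  rw [Finset.sum_comm' (t' := M.basesAbove R I 0) (s' := fun B => B \ I)]
  · simp only [← Finset.card_eq_sum_ones]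
    have h : ∀ B ∈ M.basesAbove R I 0, (B \ I).card = c + 1 := by
      intro B hB
      rw [mem_basesAbove] at hB
      have h1 := hB.1.card_eq_natRank
      have h2 := Finset.card_sdiff_add_card_eq_card hB.2.1
      omega
    rw [Finset.sum_congr rfl h, Finset.sum_const, smul_eq_mul, mul_comm]
  · intro x B
    simp only [mem_basesAbove, Finset.mem_filter, Finset.mem_sdiff, mem_extFinset,
      Finset.insert_subset_iff, Finset.card_eq_zero, Finset.filter_eq_empty_iff,
      Finset.mem_insert, not_or, and_imp]
    constructor
    · rintro ⟨⟨⟨h1, h2⟩, h3⟩, h4, ⟨h5, h6⟩, h7⟩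
      refine ⟨⟨h5, h1⟩, h4, h6, fun y hy hyI => ?_⟩
      by_cases hxy : y = x
      · rwa [hxy]
      · exact h7 hy hxy hyI
    · rintro ⟨⟨h1, h2⟩, h4, h5, h6⟩
      exact ⟨⟨⟨h2, h4.indep.subset (Set.insert_subset (by simpa using h1)
        (by simpa using h5))⟩, h6 h1 h2⟩, h4, ⟨h1, h5⟩, fun y hy _ hyI => h6 hy hyI⟩

theorem sum_indicator_mul (N : Finset α) (R : Set α) (f : α → ℝ) :
    ∑ x ∈ N, R.indicator (1 : α → ℝ) x * f x = ∑ x ∈ N.filter (· ∈ R), f x := by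
  rw [Finset.sum_filter]
  refine Finset.sum_congr rfl fun x _ => ?_
  by_cases hx : x ∈ R <;> simp [hx]

theorem sum_indicator_compl_mul (N : Finset α) (R : Set α) (f : α → ℝ) :
    ∑ x ∈ N, Rᶜ.indicator (1 : α → ℝ) x * f x = ∑ x ∈ N.filter (· ∉ R), f x := by
  rw [Finset.sum_filter]
  refine Finset.sum_congr rfl fun x _ => ?_
  by_cases hx : x ∈ R <;> simp [hx]

-- Each basis is counted once per ordering of its new elements that puts those in R first.
open scoped Nat in
theorem mixedCount_indicatorList {b c : ℕ} (hI : M.Indep (I : Set α))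
    (hcard : I.card + (b + c) = M.natRank) :
    M.mixedCount (indicatorList R b c) I = b ! * c ! * (M.basesAbove R I b).card := by
  induction b generalizing I with
  | zero =>
    induction c generalizing I with
    | zero =>
      have h : M.basesAbove R I 0 = {I} := by
        obtain ⟨B, hB, hIB⟩ := hI.exists_isBase_superset
        have hBf : B.Finite := M.ground_finite.subset hB.subset_ground
        lift B to Finset α using hBf
        have hBI : I = B := Finset.eq_of_subset_of_card_le (by simpa using hIB)
          (by rw [hB.card_eq_natRank]; omega)
        ext B'
        rw [mem_basesAbove, Finset.mem_singleton]
        constructor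
        · rintro ⟨h1, h2, -⟩
          exact (Finset.eq_of_subset_of_card_le h2 (by rw [h1.card_eq_natRank]; omega)).symm
        · rintro rfl
          exact ⟨hBI ▸ hB, subset_rfl, by simp⟩
      simp [indicatorList, h]
    | succ c ih =>
      rw [indicatorList_zero_succ, mixedCount_cons, sum_indicator_compl_mul]
      have h : ∀ x ∈ (M.extFinset I).filter (· ∉ R),
          M.mixedCount (indicatorList R 0 c) (insert x I) =
            0 ! * c ! * ((M.basesAbove R (insert x I) 0).card : ℝ) := by
        intro x hx
        have hx := (Finset.mem_filter.1 hx).1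
        refine ih (indep_insert_of_mem_extFinset hx)
          (by rw [card_insert_of_mem_extFinset hx]; omega)
      rw [Finset.sum_congr rfl h, ← Finset.mul_sum, ← Nat.cast_sum]
      have h2 := sum_card_basesAbove_insert_of_notMem (M := M) (I := I) (R := R) (c := c)
        (by omega)
      rw [h2, Nat.factorial_succ c]
      push_cast
      ring
  | succ b ih =>
    rw [indicatorList_succ_left, mixedCount_cons, sum_indicator_mul]
    have h : ∀ x ∈ (M.extFinset I).filter (· ∈ R),
        M.mixedCount (indicatorList R b c) (insert x I) =
          b ! * c ! * ((M.basesAbove R (insert x I) b).card : ℝ) := by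
      intro x hx
      have hx := (Finset.mem_filter.1 hx).1
      refine ih (indep_insert_of_mem_extFinset hx)
        (by rw [card_insert_of_mem_extFinset hx]; omega)
    rw [Finset.sum_congr rfl h, ← Finset.mul_sum, ← Nat.cast_sum,
      sum_card_basesAbove_insert_of_mem, Nat.factorial_succ b]
    push_cast
    ring

theorem ncard_coe_inter (B : Finset α) (R : Set α) :
    ((B : Set α) ∩ R).ncard = (B.filter (· ∈ R)).card := by
  rw [← Set.ncard_coe_finset]
  congr 1
  ext x
  simp

theorem baseCount_eq_card_basesAbove (M : Matroid α) [M.Finite] (R : Set α) (b : ℕ) :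
    M.baseCount R b = (M.basesAbove R ∅ b).card := by
  have h : {B : Set α | M.IsBase B ∧ (B ∩ R).ncard = b} =
      (fun B : Finset α => (B : Set α)) '' (M.basesAbove R ∅ b : Set (Finset α)) := by
    ext B
    simp only [Set.mem_ofPred_eq, Set.mem_image, Finset.mem_coe, mem_basesAbove]
    constructor
    · rintro ⟨hB, h⟩
      lift B to Finset α using M.ground_finite.subset hB.subset_ground
      rw [ncard_coe_inter] at h
      exact ⟨B, ⟨hB, by simp, by simpa using h⟩, rfl⟩
    · rintro ⟨B, ⟨hB, -, h⟩, rfl⟩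
      rw [ncard_coe_inter]
      exact ⟨hB, by simpa using h⟩
  rw [baseCount, h, Set.ncard_image_of_injective _ Finset.coe_injective, Set.ncard_coe_finset]

open scoped Nat in
theorem normBaseCount_eq_mixedCount {b c : ℕ} (h : b + c = M.natRank) :
    M.normBaseCount R b = M.mixedCount (indicatorList R b c) ∅ / M.natRank ! := by
  rw [normBaseCount, baseCount_eq_card_basesAbove,
    mixedCount_indicatorList (by simp) (by simpa using h)]
  have h1 := Nat.choose_mul_factorial_mul_factorial (n := M.natRank) (k := b) (by omega)
  have h2 : M.natRank - b = c := by omega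
  rw [h2] at h1
  have h3 : ((M.natRank.choose b : ℕ) : ℝ) ≠ 0 :=
    Nat.cast_ne_zero.2 (Nat.choose_pos (by omega)).ne'
  have h4 : (b ! : ℝ) ≠ 0 := Nat.cast_ne_zero.2 (Nat.factorial_ne_zero _)
  have h5 : (c ! : ℝ) ≠ 0 := Nat.cast_ne_zero.2 (Nat.factorial_ne_zero _)
  rw [← h1]
  push_cast
  field_simp

end Matroid

end

/-! ### Parallel classes of contractions and the equality case -/

noncomputable section

namespace Matroid

open scoped Classical

variable {α : Type*} {M : Matroid α} [M.Finite] {A : Finset α} {x y : α} {R : Set α}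

theorem contract_isNonloop_iff_mem_extFinset (hA : M.Indep (A : Set α)) :
    (M.contract A).IsNonloop x ↔ x ∈ M.extFinset A := by
  rw [← indep_singleton, hA.contract_indep_iff, mem_extFinset, Set.disjoint_singleton_left,
    Set.singleton_union, Finset.mem_coe]

theorem contract_parallelClass (hA : M.Indep (A : Set α)) (hx : x ∈ M.extFinset A) :
    (M.contract A).parallelClass x = (M.extClass A x : Set α) := by
  ext y
  simp only [parallelClass, Set.mem_ofPred_eq, extClass, Finset.coe_filter,
    contract_isNonloop_iff_mem_extFinset hA]
  refine and_congr_right fun hy => ?_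
  by_cases hxy : y = x
  · simp [hxy]
  have h := mem_extFinset_insert_iff (y := y) hA hx
  rw [and_iff_right hy, mem_extFinset, Finset.mem_insert, Finset.coe_insert, not_or,
    and_iff_right ⟨hxy, (mem_extFinset.1 hy).1⟩] at h
  have hdisj : Disjoint ({x, y} : Set α) (A : Set α) := by
    rw [Set.disjoint_left]
    rintro z (rfl | rfl)
    exacts [by simpa using (mem_extFinset.1 hx).1, by simpa using (mem_extFinset.1 hy).1]
  rw [or_iff_right hxy, hA.contract_indep_iff, and_iff_right hdisj, Set.pair_comm,
    Set.insert_union, Set.singleton_union, h, not_not, eq_comm]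

theorem sum_extClass_eq_zero_iff (hA : M.Indep (A : Set α)) (hx : x ∈ M.extFinset A) (s : ℝ) :
    ∑ y ∈ M.extClass A x, (R.indicator 1 - s • Rᶜ.indicator 1 : α → ℝ) y = 0 ↔
      (((M.contract A).parallelClass x ∩ R).ncard : ℝ) =
        s * (((M.contract A).parallelClass x ∩ (M.E \ R)).ncard : ℝ) := by
  have h1 : (M.contract A).parallelClass x ∩ (M.E \ R) =
      ((M.extClass A x).filter (· ∉ R) : Finset α) := by
    rw [contract_parallelClass hA hx]
    ext y
    simp only [Set.mem_inter_iff, Finset.mem_coe, Set.mem_sdiff, Finset.mem_filter]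
    refine and_congr_right fun hy => and_iff_right ?_
    exact (mem_extFinset.1 (Finset.mem_filter.1 hy).1).2.subset_ground (Set.mem_insert _ _)
  rw [h1, Set.ncard_coe_finset, contract_parallelClass hA hx, ncard_coe_inter,
    ← sub_eq_zero (b := s * _)]
  have h2 := sum_indicator_mul (M.extClass A x) R 1
  have h3 := sum_indicator_compl_mul (M.extClass A x) R 1
  simp only [Pi.one_apply, mul_one, Finset.sum_const, nsmul_eq_mul] at h2 h3
  rw [← h2, ← h3]
  simp only [Pi.sub_apply, Pi.smul_apply, smul_eq_mul, Finset.sum_sub_distrib, ← Finset.mul_sum]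

/-- Independent sets of size `b + c` with `b` elements in `R` are those reached from `∅` by the
indicator list. -/
theorem reaches_empty_indicatorList_iff {b c : ℕ} :
    M.Reaches ∅ (indicatorList R b c) A ↔
      M.Indep (A : Set α) ∧ A.card = b + c ∧ (A.filter (· ∈ R)).card = b := by
  constructor
  · intro h
    exact ⟨h.indep (by simp), by simpa [length_indicatorList] using h.card_eq,
      by simpa using h.card_filter⟩
  · rintro ⟨h1, h2, h3⟩
    have h4 := Finset.card_filter_add_card_filter_not (s := A) (· ∈ R)
    exact reaches_indicatorList h1 (by simp) (by simpa using h3)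
      (by rw [Finset.sdiff_empty]; omega)

theorem sq_eq_mul_iff_exists_radical {b c : ℕ} (hr : b + c + 2 = M.natRank)
    (hpos : 0 < M.mixedForm (indicatorList R b c) ∅ (R.indicator 1) (Rᶜ.indicator 1)) :
    M.mixedForm (indicatorList R b c) ∅ (R.indicator 1) (Rᶜ.indicator 1) ^ 2 =
        M.mixedForm (indicatorList R b c) ∅ (R.indicator 1) (R.indicator 1) *
          M.mixedForm (indicatorList R b c) ∅ (Rᶜ.indicator 1) (Rᶜ.indicator 1) ↔
      ∃ s : ℝ, 0 < s ∧ ∀ A : Finset α, M.Reaches ∅ (indicatorList R b c) A →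
        ∀ u, M.mixedCount [u, R.indicator 1 - s • Rᶜ.indicator 1] A = 0 := by
  set ρ : α → ℝ := R.indicator 1 with hρ
  set σ : α → ℝ := Rᶜ.indicator 1 with hσ
  set g := M.mixedForm (indicatorList R b c) ∅ with hg
  have hρ0 : ∀ x, 0 ≤ ρ x := indicator_one_nonneg R
  have hσ0 : ∀ x, 0 ≤ σ x := indicator_one_nonneg Rᶜ
  have hcard : (∅ : Finset α).card + (indicatorList R b c).length + 2 ≤ M.natRank := by
    rw [length_indicatorList, Finset.card_empty]
    omega
  have hsymm : g σ ρ = g ρ σ := mixedForm_comm _ _ _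
  constructor
  · intro h
    have hρρ : 0 < g ρ ρ := by
      refine lt_of_le_of_ne (mixedForm_self_nonneg indicatorList_nonneg hρ0) fun h0 => ?_
      rw [← h0, zero_mul] at h
      exact hpos.ne' (pow_eq_zero_iff two_ne_zero |>.1 h)
    -- This `s` makes ρ - sσ orthogonal to ρ; the assumed equality then makes it null.
    refine ⟨g ρ ρ / g ρ σ, div_pos hρρ hpos, ?_⟩
    set s := g ρ ρ / g ρ σ with hs
    have h1 : g ρ ρ = s * g ρ σ := by
      rw [hs, div_mul_cancel₀ _ hpos.ne']
    have h2 : g ρ σ = s * g σ σ := by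
      rw [h1] at h
      have : g ρ σ * (g ρ σ - s * g σ σ) = 0 := by linarith
      linarith [(mul_eq_zero.1 this).resolve_left hpos.ne']
    have h3 : g ρ (ρ - s • σ) = 0 := by
      simp only [map_sub, map_smul, smul_eq_mul]
      linarith
    have h4 : g (ρ - s • σ) (ρ - s • σ) = 0 := by
      simp only [map_sub, map_smul, smul_eq_mul, LinearMap.sub_apply, LinearMap.smul_apply, hsymm,
        h1]
      rw [h2]
      ring
    have hrad := LinearMap.BilinForm.eq_zero_of_isotropic_of_orthogonal g (mixedForm_comm _) ρ hρρ
      (mixedForm_hyperbolic indicatorList_nonneg (by simp) hcard hρ0) _ h3 h4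
    intro A hA
    refine hA.radical hρ0 hσ0 (fun x => ?_) (div_pos hρρ hpos) (fun w hw => mem_indicatorList hw)
      (by simp) hcard hrad hpos
    by_cases hx : x ∈ R <;> simp [hρ, hσ, hx]
  · rintro ⟨s, -, h⟩
    -- The form is assembled from the rank two forms above the reached sets, so it inherits their
    -- common radical vector. Pairing with ρ and σ gives the two proportions.
    have hrad : ∀ u, g u (ρ - s • σ) = 0 := by
      intro u
      rw [hg, mixedForm_apply]
      have h1 := mixedCount_append_eq_zero (ws' := [u, ρ - s • σ]) indicatorList_nonneg
        (fun A hA => h A hA u)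
      rwa [mixedCount_perm List.perm_append_comm] at h1
    have h1 := hrad ρ
    have h2 := hrad σ
    simp only [map_sub, map_smul, smul_eq_mul, hsymm] at h1 h2
    have h3 : g ρ ρ = s * g ρ σ := by linarith
    have h4 : g ρ σ = s * g σ σ := by linarith
    rw [h3, sq]
    nth_rewrite 2 [h4]
    ring

end Matroid

end

open Matroid in
open scoped Classical Nat in
theorem theorem1p3 {α : Type*} (M : Matroid α) [M.Finite] (r : ℕ) (hr : M.natRank = r)
    (hr2 : 2 ≤ r) (R : Set α) (hR : R ⊆ M.E) (a : ℕ) (ha1 : 1 ≤ a) (ha2 : a ≤ r - 1)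
    (hpos : 0 < M.normBaseCount R a) :
    M.normBaseCount R a ^ 2 = M.normBaseCount R (a + 1) * M.normBaseCount R (a - 1) ↔
      ∃ s : ℝ, 0 < s ∧
        ∀ A : Set α, M.Indep A → A.ncard = r - 2 → (A ∩ R).ncard = a - 1 →
          ∀ x : α, (M.contract A).IsNonloop x →
            (((M.contract A).parallelClass x ∩ R).ncard : ℝ) =
              s * (((M.contract A).parallelClass x ∩ (M.E \ R)).ncard : ℝ) := by
  -- With b = a - 1 and c = r - 1 - a, two of the r slots stay free for the arguments of the form.
  obtain ⟨b, rfl⟩ : ∃ b, a = b + 1 := ⟨a - 1, by omega⟩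
  obtain ⟨c, hc⟩ : ∃ c, b + c + 2 = M.natRank := ⟨r - 2 - b, by omega⟩
  have hmid : M.normBaseCount R (b + 1) = M.mixedForm (indicatorList R b c) ∅
      (R.indicator 1) (Rᶜ.indicator 1) / M.natRank ! := by
    rw [normBaseCount_eq_mixedCount (c := c + 1) (by omega), indicatorList_succ_left,
      mixedCount_perm ((indicatorList_succ_right_perm b c).cons _), mixedForm_apply]
  have htop : M.normBaseCount R (b + 1 + 1) = M.mixedForm (indicatorList R b c) ∅
      (R.indicator 1) (R.indicator 1) / M.natRank ! := by
    rw [normBaseCount_eq_mixedCount (c := c) (by omega)]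
    rfl
  have hbot : M.normBaseCount R (b + 1 - 1) = M.mixedForm (indicatorList R b c) ∅
      (Rᶜ.indicator 1) (Rᶜ.indicator 1) / M.natRank ! := by
    rw [Nat.add_sub_cancel, normBaseCount_eq_mixedCount (c := c + 1 + 1) (by omega),
      mixedCount_perm ((indicatorList_succ_right_perm b (c + 1)).trans
        ((indicatorList_succ_right_perm b c).cons _)), mixedForm_apply]
  have hfac : (0 : ℝ) < M.natRank ! := Nat.cast_pos.2 (Nat.factorial_pos _)
  rw [hmid] at hpos
  have hpos' := (div_pos_iff_of_pos_right hfac).1 hpos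
  rw [hmid, htop, hbot, div_pow, div_mul_div_comm, ← sq, div_left_inj' (by positivity),
    sq_eq_mul_iff_exists_radical hc hpos']
  refine exists_congr fun s => and_congr_right fun _ => ?_
  have key : ∀ A : Finset α, M.Indep (A : Set α) → A.card = b + c →
      ((∀ u, M.mixedCount [u, R.indicator 1 - s • Rᶜ.indicator 1] A = 0) ↔
        ∀ x : α, (M.contract A).IsNonloop x →
          (((M.contract A).parallelClass x ∩ R).ncard : ℝ) =
            s * (((M.contract A).parallelClass x ∩ (M.E \ R)).ncard : ℝ)) := by
    intro A hA hcard
    rw [mixedCount_pair_eq_zero_iff hA (by omega)]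
    refine forall_congr' fun x => ?_
    rw [contract_isNonloop_iff_mem_extFinset hA]
    exact forall_congr' fun hx => sum_extClass_eq_zero_iff hA hx s
  constructor
  · intro h A hA h1 h2
    lift A to Finset α using M.ground_finite.subset hA.subset_ground
    rw [Set.ncard_coe_finset] at h1
    rw [ncard_coe_inter] at h2
    have h3 : A.card = b + c := by omega
    exact (key A hA h3).1 (h A (reaches_empty_indicatorList_iff.2 ⟨hA, h3, h2⟩))
  · intro h A hA
    obtain ⟨h1, h2, h3⟩ := reaches_empty_indicatorList_iff.1 hA
    exact (key A h1 h2).2 (h A h1 (by rw [Set.ncard_coe_finset]; omega)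
      (by rw [ncard_coe_inter]; exact h3))
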